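/- Let $K$ be a field, $n\ge 1$, $S=K[x_1,\dots,x_n]$ with the standard grading, and let $I\subseteq S$ be a monomial ideal generated in degree $d$ such that $S/I$ is artinian. Let $$0\to F_p\to\cdots\to F_1\to F_0\to S/I\to 0,\qquad F_i=\bigoplus_{j} S(-j)^{\beta_{i,j}(S/I)},$$ be the minimal graded free resolution of $S/I$, and let $r\ge 0$ be an integer such that this resolution is linear for $r$ steps, that is, $\beta_{i,i+j}(S/I)=0$ for all $1\le i\le r$ and all $j\ge d$. Then every monomial $m$ of degree $d$ with $m\notin I$ is divisible by at least $r+1$ distinct variables, i.e. $|\operatorname{supp}(m)|\ge r+1$. In particular, writing $H_{S/I}(t)=\dim_K (S/I)_t$ for $t\in\mathbb Z$ (so $H_{S/I}(t)=0$ for $t<0$), $$H_{S/I}(d)\le \binom{n}{r+1}\,H_{S/I}(d-r-1).$$ -/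

import Mathlib

open MvPolynomial

namespace MonomialResolution

/-- The degree `t` part of the standard graded polynomial ring `K[x_1, …, x_n]`, for `t : ℤ`: the
polynomials all of whose monomials have total degree `t`. It is zero for negative `t`. -/
noncomputable def gradedPart (K : Type*) [Field K] (n : ℕ) (t : ℤ) :
    Submodule K (MvPolynomial (Fin n) K) :=
  restrictSupport K {a : Fin n →₀ ℕ | (a.degree : ℤ) = t}

/-- The degree `t` part `(S/I)_t` of `S/I`: the image of `S_t`. -/
noncomputable def quotientPart {K : Type*} [Field K] {n : ℕ}
    (I : Ideal (MvPolynomial (Fin n) K)) (t : ℤ) :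
    Submodule K (MvPolynomial (Fin n) K ⧸ I) :=
  (gradedPart K n t).map (Ideal.Quotient.mkₐ K I).toLinearMap

/-- The Hilbert function `H_{S/I}(t) = dim_K (S/I)_t`. -/
noncomputable def hilbertFunction {K : Type*} [Field K] {n : ℕ}
    (I : Ideal (MvPolynomial (Fin n) K)) (t : ℤ) : ℕ :=
  Module.finrank K (quotientPart I t)

/-- `I` is a monomial ideal: it is generated by monomials. -/
def IsMonomialIdeal {K : Type*} [Field K] {n : ℕ} (I : Ideal (MvPolynomial (Fin n) K)) : Prop :=
  ∃ A : Set (Fin n →₀ ℕ), I = Ideal.span ((fun a => monomial a (1 : K)) '' A)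

/-- `I` is generated by homogeneous polynomials of degree `d`. -/
def IsGeneratedInDegree {K : Type*} [Field K] {n : ℕ} (I : Ideal (MvPolynomial (Fin n) K))
    (d : ℕ) : Prop :=
  ∃ T : Set (MvPolynomial (Fin n) K), (∀ f ∈ T, f.IsHomogeneous d) ∧ I = Ideal.span T

/-- A minimal graded free resolution
`0 → F_p → ⋯ → F_1 → F_0 → S/I → 0` of `S/I`, where `S = K[x_1, …, x_n]`.

The module `F_i` is the free module `S ^ rank i`, graded so that the `e`-th standard basis vector
has degree `deg i e`; in other words `F_i = ⨁_e S(-deg i e)`. -/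
structure MinimalFreeResolution {K : Type*} [Field K] {n : ℕ}
    (I : Ideal (MvPolynomial (Fin n) K)) where
  /-- the rank of `F_i` -/
  rank : ℕ → ℕ
  /-- the degrees of the basis elements of `F_i` -/
  deg : (i : ℕ) → Fin (rank i) → ℤ
  /-- the differential `F_{i+1} → F_i` -/
  diff : (i : ℕ) → (Fin (rank (i + 1)) → MvPolynomial (Fin n) K) →ₗ[MvPolynomial (Fin n) K]
    (Fin (rank i) → MvPolynomial (Fin n) K)
  /-- the augmentation `F_0 → S/I` -/
  aug : (Fin (rank 0) → MvPolynomial (Fin n) K) →ₗ[MvPolynomial (Fin n) K]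
    (MvPolynomial (Fin n) K ⧸ I)
  /-- the resolution has finite length -/
  finite_length : ∃ p : ℕ, ∀ i, p < i → rank i = 0
  /-- the differentials preserve degrees -/
  diff_graded : ∀ (i : ℕ) (e : Fin (rank (i + 1))) (e' : Fin (rank i)),
    diff i (Pi.single e 1) e' ∈ gradedPart K n (deg (i + 1) e - deg i e')
  /-- the augmentation preserves degrees -/
  aug_graded : ∀ e : Fin (rank 0), aug (Pi.single e 1) ∈ quotientPart I (deg 0 e)
  /-- exactness at `S/I` -/
  aug_surjective : Function.Surjective aug
  /-- exactness at `F_0` -/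
  exact_zero : Function.Exact (diff 0) aug
  /-- exactness at `F_{i+1}` -/
  exact_succ : ∀ i : ℕ, Function.Exact (diff (i + 1)) (diff i)
  /-- minimality: the image of `F_{i+1}` lies in `(x_1, …, x_n) F_i` -/
  minimal : ∀ i : ℕ, LinearMap.range (diff i) ≤
    Ideal.span (Set.range (X : Fin n → MvPolynomial (Fin n) K)) •
      (⊤ : Submodule (MvPolynomial (Fin n) K) (Fin (rank i) → MvPolynomial (Fin n) K))

/-- The graded Betti number `β_{i,j}(S/I)`: the number of copies of `S(-j)` in `F_i`. -/
def MinimalFreeResolution.betti {K : Type*} [Field K] {n : ℕ}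
    {I : Ideal (MvPolynomial (Fin n) K)} (F : MinimalFreeResolution I) (i : ℕ) (j : ℤ) : ℕ :=
  Fintype.card {e : Fin (F.rank i) // F.deg i e = j}

/-- The minimal free resolution of `S/I` (with `I` generated in degree `d`) is linear for `r`
steps: `β_{i,i+j}(S/I) = 0` for all `1 ≤ i ≤ r` and all `j ≥ d`. -/
def MinimalFreeResolution.IsLinearForSteps {K : Type*} [Field K] {n : ℕ}
    {I : Ideal (MvPolynomial (Fin n) K)} (F : MinimalFreeResolution I) (d r : ℕ) : Prop :=
  ∀ i : ℕ, 1 ≤ i → i ≤ r → ∀ j : ℤ, (d : ℤ) ≤ j → F.betti i (i + j) = 0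

end MonomialResolution

/-! Suppose a monomial outside `I`, of degree `d`, has support of size `p + 1 ≤ r`. As `S/I` is
artinian, it divides a monomial `a ∉ I` with the same support such that `x_i a ∈ I` for every `i` in
the support (`IsMonomialIdeal.exists_socle`). Then `a ⊗ e_τ`, with `τ` the support, is a Koszul
cycle on `S/I`. It is not a boundary: the `e_τ`-coefficient of a boundary lies in the ideal of the
variables outside `τ`, which do not divide `a`. So it is a nonzero class of `Tor_{p+1}(S/I, K)` in
degree `deg a + p + 1 ≥ d + p + 1`, against linearity at step `p + 1`. The passage from Koszul
homology to the resolution is a chase in the double complex of Koszul chains on the `F_i`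
(`MinimalFreeResolution.exists_koszul_add`), resting on exactness of the Koszul complex of a free
module (`exists_koszul_eq`). Koszul chains are alternating maps on `K ^ n`, with differential `∑ x_i
ι_{e_i}`. The Hilbert function bound follows by splitting a squarefree factor of degree `r + 1` off
each monomial. -/

namespace AlternatingMap

/-! ### Contraction and wedge product of alternating maps. -/

variable {R V N : Type*} [CommRing R] [AddCommGroup V] [AddCommGroup N] [Module R V] [Module R N]

/-- Polarization of the vanishing of the double contraction with `u + v`. -/
theorem curryLeft_curryLeft_swap {p : ℕ} (f : V [⋀^Fin (p + 2)]→ₗ[R] N) (u v : V) :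
    (f.curryLeft u).curryLeft v = -(f.curryLeft v).curryLeft u := by
  have h := f.curryLeft_same (u + v)
  have e : (f.curryLeft (u + v)).curryLeft (u + v) =
      (f.curryLeft u).curryLeft u + (f.curryLeft u).curryLeft v +
        ((f.curryLeft v).curryLeft u + (f.curryLeft v).curryLeft v) := by
    simp only [map_add, curryLeft_add, LinearMap.add_apply]
    abel
  rw [e, curryLeft_same, curryLeft_same] at h
  rw [eq_neg_iff_add_eq_zero]
  simpa using h

/-- The wedge product `φ ∧ ω` of a linear form and an alternating map. -/
def wedgeLeft {p : ℕ} (φ : V →ₗ[R] R) (ω : V [⋀^Fin p]→ₗ[R] N) : V [⋀^Fin (p + 1)]→ₗ[R] N :=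
  alternatizeUncurryFin (φ.smulRight ω)

theorem curryLeft_wedgeLeft_zero (φ : V →ₗ[R] R) (ω : V [⋀^Fin 0]→ₗ[R] N) (v : V) :
    (wedgeLeft φ ω).curryLeft v = φ v • ω := by
  ext w
  simp only [wedgeLeft, curryLeft_apply_apply, alternatizeUncurryFin_apply]
  simp

/-- Contraction is an antiderivation: the term of index `0` of the alternatization gives `φ v • ω`,
and the others, shifted by one, change sign. -/
theorem curryLeft_wedgeLeft {p : ℕ} (φ : V →ₗ[R] R) (ω : V [⋀^Fin (p + 1)]→ₗ[R] N) (v : V) :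
    (wedgeLeft φ ω).curryLeft v = φ v • ω - wedgeLeft φ (ω.curryLeft v) := by
  ext w
  simp only [wedgeLeft, curryLeft_apply_apply, alternatizeUncurryFin_apply, sub_apply]
  rw [Fin.sum_univ_succ, sub_eq_add_neg, ← Finset.sum_neg_distrib]
  congr 1
  · simp [Matrix.vecCons]
  · refine Finset.sum_congr rfl fun i _ => ?_
    have : i.succ.removeNth (Matrix.vecCons v w) = Matrix.vecCons v (i.removeNth w) := by
      ext j
      refine Fin.cases ?_ (fun j => ?_) j <;> simp [Fin.removeNth, Matrix.vecCons]
    rw [this]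
    simp [pow_succ]

theorem wedgeLeft_zero_right {p : ℕ} (φ : V →ₗ[R] R) :
    wedgeLeft φ (0 : V [⋀^Fin p]→ₗ[R] N) = 0 := by
  ext v
  simp [wedgeLeft, alternatizeUncurryFin_apply]

theorem wedgeLeft_add {p : ℕ} (φ : V →ₗ[R] R) (ω η : V [⋀^Fin p]→ₗ[R] N) :
    wedgeLeft φ (ω + η) = wedgeLeft φ ω + wedgeLeft φ η := by
  ext v
  simp [wedgeLeft, alternatizeUncurryFin_apply, Finset.sum_add_distrib]

theorem wedgeLeft_neg {p : ℕ} (φ : V →ₗ[R] R) (ω : V [⋀^Fin p]→ₗ[R] N) :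
    wedgeLeft φ (-ω) = -wedgeLeft φ ω := by
  rw [eq_neg_iff_add_eq_zero, ← wedgeLeft_add, neg_add_cancel, wedgeLeft_zero_right]

theorem wedgeLeft_smul {p : ℕ} {S : Type*} [Monoid S] [DistribMulAction S N] [SMulCommClass R S N]
    (φ : V →ₗ[R] R) (s : S) (ω : V [⋀^Fin p]→ₗ[R] N) :
    wedgeLeft φ (s • ω) = s • wedgeLeft φ ω := by
  ext v
  simp only [wedgeLeft, alternatizeUncurryFin_apply, smul_apply, Finset.smul_sum,
    LinearMap.smulRight_apply]
  refine Finset.sum_congr rfl fun i _ => ?_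
  rw [smul_comm _ s, smul_comm ((-1 : ℤ) ^ (i : ℕ)) s]

theorem wedgeLeft_sum {p : ℕ} {ι : Type*} (T : Finset ι) (φ : V →ₗ[R] R)
    (ω : ι → V [⋀^Fin p]→ₗ[R] N) :
    wedgeLeft φ (∑ i ∈ T, ω i) = ∑ i ∈ T, wedgeLeft φ (ω i) :=
  map_sum (AddMonoidHom.mk' (wedgeLeft φ) (wedgeLeft_add φ)) _ _

/-- Subtracting `φ ∧ ι_u ω` from `ω`, where `φ u = 1`, makes the contraction with `u` vanish. -/
theorem curryLeft_sub_wedgeLeft_self {p : ℕ} (φ : V →ₗ[R] R) (u : V) (hu : φ u = 1)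
    (ω : V [⋀^Fin (p + 1)]→ₗ[R] N) :
    (ω - wedgeLeft φ (ω.curryLeft u)).curryLeft u = 0 := by
  have : (ω - wedgeLeft φ (ω.curryLeft u)).curryLeft u =
    ω.curryLeft u - (wedgeLeft φ (ω.curryLeft u)).curryLeft u := rfl
  rw [this]
  cases p with
  | zero => rw [curryLeft_wedgeLeft_zero, hu, one_smul, sub_self]
  | succ p =>
    rw [curryLeft_wedgeLeft, hu, one_smul, curryLeft_same, wedgeLeft_zero_right, sub_zero, sub_self]

/-- Contractions anticommute, so removing the `u`-contraction keeps the vanishing already obtained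
for `v`. This allows basis vectors to be treated one at a time. -/
theorem curryLeft_sub_wedgeLeft_of_eq_zero {p : ℕ} (φ : V →ₗ[R] R) (u v : V) (hv : φ v = 0)
    (ω : V [⋀^Fin (p + 1)]→ₗ[R] N) (hω : ω.curryLeft v = 0) :
    (ω - wedgeLeft φ (ω.curryLeft u)).curryLeft v = 0 := by
  have : (ω - wedgeLeft φ (ω.curryLeft u)).curryLeft v =
    ω.curryLeft v - (wedgeLeft φ (ω.curryLeft u)).curryLeft v := rfl
  rw [this, hω]
  cases p with
  | zero => rw [curryLeft_wedgeLeft_zero, hv, zero_smul, sub_self]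
  | succ p =>
    rw [curryLeft_wedgeLeft, hv, zero_smul, curryLeft_curryLeft_swap, hω, curryLeft_zero]
    simp [wedgeLeft_zero_right]

/-- Over a field, an alternating map with values in `g(A)` lifts along `g` to an alternating map
with values in `A`. -/
theorem exists_lift {K V M N : Type*} [Field K] [AddCommGroup V] [AddCommGroup M] [AddCommGroup N]
    [Module K V] [Module K M] [Module K N] {ι : Type*} (g : M →ₗ[K] N) (A : Submodule K M)
    (ω : V [⋀^ι]→ₗ[K] N) (h : ∀ v, ω v ∈ A.map g) :
    ∃ η : V [⋀^ι]→ₗ[K] M, (∀ v, η v ∈ A) ∧ g.compAlternatingMap η = ω := by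
  -- A `K`-linear section of `A → g(A)`; composing with it preserves alternation.
  obtain ⟨s, hs⟩ := (g.submoduleMap A).exists_rightInverse_of_surjective
    (LinearMap.range_eq_top.2 (g.submoduleMap_surjective A))
  refine ⟨(A.subtype ∘ₗ s).compAlternatingMap (ω.codRestrict _ h), fun v => ?_, ?_⟩
  · exact (s _).2
  · ext v
    have := congrArg Subtype.val (LinearMap.congr_fun hs (ω.codRestrict _ h v))
    simpa using this

theorem eq_zero_of_curryLeft_single {K N : Type*} [Field K] {n p : ℕ} [AddCommGroup N]
    [Module K N] (ω : (Fin n → K) [⋀^Fin (p + 1)]→ₗ[K] N)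
    (h : ∀ i, ω.curryLeft (Pi.single i 1) = 0) : ω = 0 := by
  have : ω.curryLeft = 0 := by
    refine (Pi.basisFun K (Fin n)).ext fun i => ?_
    simp [h i]
  ext v
  have := congrArg (fun f => f (v 0) (fun j => v j.succ)) this
  simp only [curryLeft_apply_apply, LinearMap.zero_apply,
    zero_apply] at this
  rw [zero_apply, ← this]
  congr 1
  ext j : 1
  refine Fin.cases rfl (fun _ => rfl) j

end AlternatingMap

namespace MonomialResolution

/-! ### The Koszul complex and its exactness on free modules. -/

section Koszul

variable {K : Type*} [Field K] {n : ℕ}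
  {M N : Type*} [AddCommGroup M] [Module K M] [Module (MvPolynomial (Fin n) K) M]
  [IsScalarTower K (MvPolynomial (Fin n) K) M]
  [AddCommGroup N] [Module K N] [Module (MvPolynomial (Fin n) K) N]
  [IsScalarTower K (MvPolynomial (Fin n) K) N]

/-- The differential of the Koszul complex of `M` with respect to the variables, whose degree `p`
part consists of the alternating maps `(K ^ n) ^ p → M`. -/
noncomputable def koszul {p : ℕ} (ω : (Fin n → K) [⋀^Fin (p + 1)]→ₗ[K] M) :
    (Fin n → K) [⋀^Fin p]→ₗ[K] M :=
  ∑ i, (X i : MvPolynomial (Fin n) K) • ω.curryLeft (Pi.single i 1)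

theorem koszul_apply {p : ℕ} (ω : (Fin n → K) [⋀^Fin (p + 1)]→ₗ[K] M) (v : Fin p → Fin n → K) :
    koszul ω v = ∑ i, (X i : MvPolynomial (Fin n) K) • ω (Matrix.vecCons (Pi.single i 1) v) := by
  exact map_sum (AddMonoidHom.mk' (fun f : (Fin n → K) [⋀^Fin p]→ₗ[K] M => f v) fun _ _ => rfl) _ _

theorem koszul_sub {p : ℕ} (ω η : (Fin n → K) [⋀^Fin (p + 1)]→ₗ[K] M) :
    koszul (ω - η) = koszul ω - koszul η := by
  ext v
  simp [koszul_apply, smul_sub]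

theorem koszul_koszul {p : ℕ} (ω : (Fin n → K) [⋀^Fin (p + 2)]→ₗ[K] M) :
    koszul (koszul ω) = 0 := by
  ext v
  simp only [koszul_apply, Finset.smul_sum, smul_smul, AlternatingMap.zero_apply]
  rw [← Fintype.sum_prod_type']
  -- The terms `(i, j)` and `(j, i)` cancel, and the diagonal terms vanish.
  refine Finset.sum_involution (fun a _ => a.swap) ?_ ?_ (by simp) (by simp)
  · rintro ⟨i, j⟩ -
    have := congrArg (fun f => f v)
      (ω.curryLeft_curryLeft_swap (Pi.single j 1) (Pi.single i 1))
    simp only [AlternatingMap.neg_apply, AlternatingMap.curryLeft_apply_apply] at this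
    simp only [Prod.fst_swap, Prod.snd_swap]
    rw [this, mul_comm (X i), smul_neg, neg_add_cancel]
  · rintro ⟨i, j⟩ - h hij
    obtain rfl : j = i := congrArg Prod.fst hij
    apply h
    have := congrArg (fun f => f v) (ω.curryLeft_same (Pi.single j 1))
    simp only [AlternatingMap.zero_apply, AlternatingMap.curryLeft_apply_apply] at this
    simp only [this, smul_zero]

theorem koszul_compAlternatingMap {p : ℕ} (g : M →ₗ[MvPolynomial (Fin n) K] N)
    (ω : (Fin n → K) [⋀^Fin (p + 1)]→ₗ[K] M) :
    koszul ((g.restrictScalars K).compAlternatingMap ω) =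
      (g.restrictScalars K).compAlternatingMap (koszul ω) := by
  ext v
  simp [koszul_apply]

/-- `δ` divides by the variable `x_i`, forgetting the remainder. -/
structure IsDivision (i : Fin n) (δ : M →ₗ[K] M) : Prop where
  X_smul_self : ∀ m : M, δ ((X i : MvPolynomial (Fin n) K) • m) = m
  X_smul_of_ne : ∀ j, j ≠ i → ∀ m : M,
    δ ((X j : MvPolynomial (Fin n) K) • m) = (X j : MvPolynomial (Fin n) K) • δ m

/-- A Koszul cycle is homologous to a cycle whose contraction with `e_i` vanishes. -/
theorem IsDivision.exists_koszul_sub {p : ℕ} {i : Fin n} {δ : M →ₗ[K] M} (hδ : IsDivision i δ)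
    (ω : (Fin n → K) [⋀^Fin (p + 1)]→ₗ[K] M) (hω : koszul ω = 0) :
    ∃ η : (Fin n → K) [⋀^Fin (p + 2)]→ₗ[K] M,
      (ω - koszul η).curryLeft (Pi.single i 1) = 0 ∧
      ∀ j, ω.curryLeft (Pi.single j 1) = 0 → (ω - koszul η).curryLeft (Pi.single j 1) = 0 := by
  set φ : (Fin n → K) →ₗ[K] K := LinearMap.proj i with hφ
  set ω' := ω - (X i : MvPolynomial (Fin n) K) • δ.compAlternatingMap ω with hω'
  -- `ω'` is the remainder of `ω` on division by `x_i`. The correction by `φ ∧ δω` leaves this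
  -- remainder with its `e_i`-contraction removed.
  have key : ω - koszul (AlternatingMap.wedgeLeft φ (δ.compAlternatingMap ω)) =
      ω' - AlternatingMap.wedgeLeft φ (ω'.curryLeft (Pi.single i 1)) := by
    have h1 : koszul (AlternatingMap.wedgeLeft φ (δ.compAlternatingMap ω)) =
        (X i : MvPolynomial (Fin n) K) • δ.compAlternatingMap ω -
        AlternatingMap.wedgeLeft φ (koszul (δ.compAlternatingMap ω)) := by
      simp only [koszul, AlternatingMap.curryLeft_wedgeLeft, smul_sub, Finset.sum_sub_distrib,
        AlternatingMap.wedgeLeft_sum, AlternatingMap.wedgeLeft_smul]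
      congr 1
      rw [Finset.sum_eq_single i _ (by simp)]
      · simp [hφ]
      · intro j _ hj
        simp [hφ, hj.symm]
    -- Apply `δ` to `koszul ω = 0`: the `i`-th term becomes `ι_{e_i} ω`, and `δ` commutes with the
    -- other variables.
    have h2 : koszul (δ.compAlternatingMap ω) = -ω'.curryLeft (Pi.single i 1) := by
      ext v
      have := congrArg (fun f => δ (f v)) hω
      simp only [koszul_apply, AlternatingMap.zero_apply, map_sum, map_zero] at this
      rw [← Finset.add_sum_erase _ _ (Finset.mem_univ i), hδ.X_smul_self] at this
      rw [koszul_apply, ← Finset.add_sum_erase _ _ (Finset.mem_univ i)]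
      rw [Finset.sum_congr rfl fun j hj => hδ.X_smul_of_ne j (Finset.ne_of_mem_erase hj) _] at this
      simp only [LinearMap.compAlternatingMap_apply, hω', AlternatingMap.neg_apply,
        AlternatingMap.curryLeft_apply_apply, AlternatingMap.sub_apply, AlternatingMap.smul_apply]
      rw [eq_neg_of_add_eq_zero_right this]
      abel
    rw [h1, h2, AlternatingMap.wedgeLeft_neg, hω']
    abel
  have hdual : ∀ j, j ≠ i → φ (Pi.single j 1) = 0 := fun j hj => by
    simp [hφ, hj.symm]
  refine ⟨_, by
    rw [key]
    exact AlternatingMap.curryLeft_sub_wedgeLeft_self _ _ (by simp [hφ]) _, fun j hj => ?_⟩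
  rw [key]
  by_cases hji : j = i
  · subst hji
    exact AlternatingMap.curryLeft_sub_wedgeLeft_self _ _ (by simp [hφ]) _
  · refine AlternatingMap.curryLeft_sub_wedgeLeft_of_eq_zero _ _ _ (hdual j hji) _ ?_
    ext v
    have := congrArg (fun f => f v) hj
    simp only [AlternatingMap.curryLeft_apply_apply, AlternatingMap.zero_apply] at this
    simp [hω', this]

/-- The Koszul complex is exact in positive degrees. -/
theorem exists_koszul_eq {p : ℕ} (δ : Fin n → M →ₗ[K] M) (hδ : ∀ i, IsDivision i (δ i))
    (ω : (Fin n → K) [⋀^Fin (p + 1)]→ₗ[K] M) (hω : koszul ω = 0) :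
    ∃ η : (Fin n → K) [⋀^Fin (p + 2)]→ₗ[K] M, koszul η = ω := by
  -- A chain of positive degree whose contractions with all basis vectors vanish is zero, so the
  -- variables can be eliminated in turn.
  suffices H : ∀ T : Finset (Fin n), ∃ η : (Fin n → K) [⋀^Fin (p + 2)]→ₗ[K] M,
      ∀ i ∈ T, (ω - koszul η).curryLeft (Pi.single i 1) = 0 by
    obtain ⟨η, h⟩ := H Finset.univ
    exact ⟨η, (sub_eq_zero.1 (AlternatingMap.eq_zero_of_curryLeft_single _ fun i => h i (Finset.mem_univ i))).symm⟩
  intro T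
  induction T using Finset.induction_on with
  | empty => exact ⟨0, by simp⟩
  | insert i T _ ih =>
    obtain ⟨η, h⟩ := ih
    obtain ⟨η', h1, h2⟩ := (hδ i).exists_koszul_sub (ω - koszul η)
      (by rw [koszul_sub, koszul_koszul, hω, sub_zero])
    refine ⟨η + η', fun j hj => ?_⟩
    have e : ω - koszul (η + η') = ω - koszul η - koszul η' := by
      rw [sub_sub]
      congr 1
      ext v
      simp [koszul_apply, Finset.sum_add_distrib]
    rw [e]
    rcases Finset.mem_insert.1 hj with rfl | hj
    · exact h1
    · exact h2 j (h j hj)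

/-- Division by `x_i` in a free module. -/
noncomputable def divX (K : Type*) [Field K] {n : ℕ} (ρ : ℕ) (i : Fin n) :
    (Fin ρ → MvPolynomial (Fin n) K) →ₗ[K] (Fin ρ → MvPolynomial (Fin n) K) where
  toFun f e := (f e).divMonomial (Finsupp.single i 1)
  map_add' f g := by
    ext1 e
    exact add_divMonomial _ _ _
  map_smul' c f := by
    ext e m
    simp [coeff_divMonomial]

theorem isDivision_divX (ρ : ℕ) (i : Fin n) : IsDivision i (divX K ρ i) where
  X_smul_self f := by
    ext1 e
    exact X_mul_divMonomial _ _
  X_smul_of_ne j hj f := by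
    ext e m
    have h : (j ∈ (Finsupp.single i 1 + m).support) ↔ j ∈ m.support := by
      simp [hj.symm]
    simp only [divX, LinearMap.coe_mk, AddHom.coe_mk, Pi.smul_apply, smul_eq_mul,
      coeff_divMonomial, coeff_X_mul', h]
    refine if_ctx_congr Iff.rfl (fun hm => ?_) fun _ => rfl
    congr 1
    ext k
    by_cases hk : k = j
    · subst hk
      simp [hj.symm]
    · simp [Finsupp.single_apply, Ne.symm hk]

end Koszul

end MonomialResolution

namespace MonomialResolution

/-! ### Graded pieces of free modules and graded maps. -/

section Support

variable {K σ : Type*} [Field K]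

theorem mul_mem_restrictSupport {s t u : Set (σ →₀ ℕ)} (h : ∀ a ∈ s, ∀ b ∈ t, a + b ∈ u)
    {f g : MvPolynomial σ K} (hf : f ∈ restrictSupport K s) (hg : g ∈ restrictSupport K t) :
    f * g ∈ restrictSupport K u := by
  have := Submodule.mul_mem_mul hf hg
  rw [← restrictSupport_add] at this
  exact restrictSupport_mono K (Set.add_subset_iff.2 h) this

theorem exists_restrictSupport_add (s : Set (σ →₀ ℕ)) (f : MvPolynomial σ K) :
    ∃ g ∈ restrictSupport K s, ∃ h ∈ restrictSupport K sᶜ, g + h = f := by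
  have : restrictSupport K s ⊔ restrictSupport K sᶜ = ⊤ := by
    rw [restrictSupport_eq_span, restrictSupport_eq_span, ← Submodule.span_union,
      ← Set.image_union, Set.union_compl_self, ← restrictSupport_eq_span, restrictSupport_univ]
  exact Submodule.mem_sup.1 (this ▸ Submodule.mem_top)

theorem eq_zero_of_mem_restrictSupport {s t : Set (σ →₀ ℕ)} (hst : Disjoint s t)
    {f : MvPolynomial σ K} (hs : f ∈ restrictSupport K s) (ht : f ∈ restrictSupport K t) :
    f = 0 := by
  rw [mem_restrictSupport_iff] at hs ht
  rw [← support_eq_empty, Finset.eq_empty_iff_forall_notMem]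
  exact fun a ha => Set.disjoint_left.1 hst (hs ha) (ht ha)

end Support

section Graded

variable {K : Type*} [Field K] {n : ℕ}

/-- The elements of `⨁_e S(-deg e)` all of whose homogeneous components have degree in `T`. -/
noncomputable def freePart (K : Type*) [Field K] (n : ℕ) {ρ : ℕ} (deg : Fin ρ → ℤ) (T : Set ℤ) :
    Submodule K (Fin ρ → MvPolynomial (Fin n) K) :=
  Submodule.pi Set.univ fun e => restrictSupport K {a | (a.degree : ℤ) + deg e ∈ T}

theorem mem_freePart {ρ : ℕ} {deg : Fin ρ → ℤ} {T : Set ℤ}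
    {f : Fin ρ → MvPolynomial (Fin n) K} :
    f ∈ freePart K n deg T ↔
      ∀ e, f e ∈ restrictSupport K {a : Fin n →₀ ℕ | (a.degree : ℤ) + deg e ∈ T} := by
  simp [freePart, Submodule.mem_pi]

theorem exists_freePart_add {ρ : ℕ} (deg : Fin ρ → ℤ) (T : Set ℤ)
    (f : Fin ρ → MvPolynomial (Fin n) K) :
    ∃ g ∈ freePart K n deg T, ∃ h ∈ freePart K n deg Tᶜ, g + h = f := by
  choose g hg h hh hgh using fun e =>
    exists_restrictSupport_add {a : Fin n →₀ ℕ | (a.degree : ℤ) + deg e ∈ T} (f e)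
  exact ⟨g, mem_freePart.2 hg, h, mem_freePart.2 hh, funext hgh⟩

theorem eq_zero_of_mem_freePart {ρ : ℕ} {deg : Fin ρ → ℤ} {T : Set ℤ}
    {f : Fin ρ → MvPolynomial (Fin n) K} (h : f ∈ freePart K n deg T)
    (h' : f ∈ freePart K n deg Tᶜ) : f = 0 := by
  funext e
  exact eq_zero_of_mem_restrictSupport (Set.disjoint_left.2 fun _ ha hb => absurd ha hb)
    (mem_freePart.1 h e) (mem_freePart.1 h' e)

theorem X_smul_mem_freePart {ρ : ℕ} {deg : Fin ρ → ℤ} {t : ℤ}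
    {f : Fin ρ → MvPolynomial (Fin n) K} (h : f ∈ freePart K n deg {t}) (i : Fin n) :
    (X i : MvPolynomial (Fin n) K) • f ∈ freePart K n deg {t + 1} := by
  rw [mem_freePart] at h ⊢
  intro e
  refine mul_mem_restrictSupport (s := {Finsupp.single i 1}) ?_ ?_ (h e)
  · rintro _ rfl b hb
    simp only [Set.mem_ofPred_eq, Set.mem_singleton_iff, map_add, Finsupp.degree_single] at hb ⊢
    push_cast
    omega
  · exact (monomial_mem_restrictSupport K).2 (Or.inl rfl)

/-- A homomorphism of free modules is graded of degree zero. -/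
def IsGradedMap {ρ ρ' : ℕ} (deg' : Fin ρ' → ℤ) (deg : Fin ρ → ℤ)
    (φ : (Fin ρ' → MvPolynomial (Fin n) K) →ₗ[MvPolynomial (Fin n) K]
      (Fin ρ → MvPolynomial (Fin n) K)) : Prop :=
  ∀ e e', φ (Pi.single e 1) e' ∈ gradedPart K n (deg' e - deg e')

theorem IsGradedMap.map_mem {ρ ρ' : ℕ} {deg' : Fin ρ' → ℤ} {deg : Fin ρ → ℤ}
    {φ : (Fin ρ' → MvPolynomial (Fin n) K) →ₗ[MvPolynomial (Fin n) K]
      (Fin ρ → MvPolynomial (Fin n) K)} (hφ : IsGradedMap deg' deg φ) {T : Set ℤ}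
    {f : Fin ρ' → MvPolynomial (Fin n) K} (hf : f ∈ freePart K n deg' T) :
    φ f ∈ freePart K n deg T := by
  rw [mem_freePart] at hf ⊢
  intro e'
  rw [pi_eq_sum_univ' f, map_sum, Finset.sum_apply]
  refine Submodule.sum_mem _ fun e _ => ?_
  rw [map_smul, Pi.smul_apply, smul_eq_mul]
  have := hφ e e'
  refine mul_mem_restrictSupport ?_ (hf e) (by convert! this using 3)
  intro a ha b hb
  simp only [Set.mem_ofPred_eq, map_add] at ha hb ⊢
  convert ha using 1
  push_cast
  omega

theorem IsGradedMap.exists_preimage {ρ ρ' : ℕ} {deg' : Fin ρ' → ℤ} {deg : Fin ρ → ℤ}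
    {φ : (Fin ρ' → MvPolynomial (Fin n) K) →ₗ[MvPolynomial (Fin n) K]
      (Fin ρ → MvPolynomial (Fin n) K)} (hφ : IsGradedMap deg' deg φ) {T : Set ℤ}
    {f : Fin ρ → MvPolynomial (Fin n) K} (hf : f ∈ freePart K n deg T)
    (hr : f ∈ LinearMap.range φ) : f ∈ (freePart K n deg' T).map (φ.restrictScalars K) := by
  obtain ⟨y, rfl⟩ := hr
  -- The part `h` of the preimage in degrees outside `T` has image in degrees both inside and
  -- outside `T`, hence zero.
  obtain ⟨g, hg, h, hh, rfl⟩ := exists_freePart_add deg' T y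
  refine ⟨g, hg, ?_⟩
  have h0 : φ h = 0 := by
    refine eq_zero_of_mem_freePart ?_ (hφ.map_mem hh)
    have := Submodule.sub_mem _ hf (hφ.map_mem hg)
    rwa [map_add, add_sub_cancel_left] at this
  simp [h0]

end Graded

/-! ### Comparing the Koszul complex with the resolution. -/

section Resolution

variable {K : Type*} [Field K] {n : ℕ}

/-- An element of `⨁_e S(-deg e)` of degree larger than all `deg e` is a combination of the
variables. -/
theorem exists_koszul_eq_of_lt {ρ : ℕ} {deg : Fin ρ → ℤ} {t : ℤ} (ht : ∀ e, deg e < t)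
    (y : (Fin n → K) [⋀^Fin 0]→ₗ[K] (Fin ρ → MvPolynomial (Fin n) K))
    (hy : ∀ v, y v ∈ freePart K n deg {t}) :
    ∃ w : (Fin n → K) [⋀^Fin 1]→ₗ[K] (Fin ρ → MvPolynomial (Fin n) K), koszul w = y := by
  -- Since `t > deg e`, the component `y 0 e` has no constant term.
  have key : ∀ e, ∃ c : Fin n → MvPolynomial (Fin n) K, ∑ i, c i * X i = y 0 e := by
    intro e
    rw [← Ideal.mem_span_range_iff_exists_fun, ← Set.image_univ, mem_ideal_span_X_image]
    intro a ha
    have h := (mem_restrictSupport_iff K).1 (mem_freePart.1 (hy 0) e) ha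
    simp only [Set.mem_ofPred_eq, Set.mem_singleton_iff] at h
    by_contra! hc
    have : a = 0 := by
      ext i
      exact hc i trivial
    subst this
    have := ht e
    simp at h
    omega
  choose c hc using key
  refine ⟨AlternatingMap.ofSubsingleton K (Fin n → K) _ (0 : Fin 1)
    (∑ i, (LinearMap.proj i : (Fin n → K) →ₗ[K] K).smulRight fun e => c e i), ?_⟩
  ext1 v
  obtain rfl : v = 0 := Subsingleton.elim _ _
  funext e
  rw [koszul_apply, Finset.sum_apply, ← hc e]
  refine Finset.sum_congr rfl fun i _ => ?_
  rw [Pi.smul_apply, smul_eq_mul, mul_comm]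
  congr 1
  rw [AlternatingMap.ofSubsingleton_apply_apply, LinearMap.sum_apply, Finset.sum_apply,
    Finset.sum_eq_single i _ (by simp)]
  · simp
  · intro j _ hj
    simp [hj]

variable {I : Ideal (MvPolynomial (Fin n) K)}

/-- One step of the chase. Lift `koszul z` to a chain `y` on `F_{i+1}`; if `y = koszul w + ∂w'`,
then `z - ∂w` is a Koszul cycle on the free module `F_i`, hence a Koszul boundary. -/
theorem MinimalFreeResolution.exists_koszul_add_of_lift (F : MinimalFreeResolution I) {p i : ℕ}
    {t : ℤ} (z : (Fin n → K) [⋀^Fin (p + 1)]→ₗ[K] (Fin (F.rank i) → MvPolynomial (Fin n) K))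
    (hz : ∀ v, z v ∈ freePart K n (F.deg i) {t})
    (hk : ∀ v, koszul z v ∈ LinearMap.range (F.diff i))
    (H : ∀ y : (Fin n → K) [⋀^Fin p]→ₗ[K] (Fin (F.rank (i + 1)) → MvPolynomial (Fin n) K),
      (∀ v, y v ∈ freePart K n (F.deg (i + 1)) {t + 1}) →
      ((F.diff i).restrictScalars K).compAlternatingMap y = koszul z →
      ∃ w w', y = koszul w + ((F.diff (i + 1)).restrictScalars K).compAlternatingMap w') :
    ∃ w w', z = koszul w + ((F.diff i).restrictScalars K).compAlternatingMap w' := by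
  obtain ⟨y, hy, hyz⟩ := AlternatingMap.exists_lift ((F.diff i).restrictScalars K)
    (freePart K n (F.deg (i + 1)) {t + 1}) (koszul z) fun v => by
      refine IsGradedMap.exists_preimage (F.diff_graded i) ?_ (hk v)
      rw [koszul_apply]
      exact Submodule.sum_mem _ fun j _ => X_smul_mem_freePart (hz _) j
  obtain ⟨w, w', hw⟩ := H y hy hyz
  obtain ⟨u, hu⟩ := exists_koszul_eq (divX K _) (isDivision_divX _)
    (z - ((F.diff i).restrictScalars K).compAlternatingMap w) (by
      rw [koszul_sub, koszul_compAlternatingMap, ← hyz, hw]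
      ext1 v
      simp [(F.exact_succ i).apply_apply_eq_zero])
  exact ⟨u, w, by rw [hu, sub_add_cancel]⟩

/-- The comparison of the Koszul complex with a free resolution: if `F_{i + p + 1}` is generated
in degrees less than `t + p + 1`, then a Koszul chain of degree `p + 1` with values in `(F_i)_t`
that is a cycle modulo the image of `F_{i + 1}` is a boundary modulo that image. -/
theorem MinimalFreeResolution.exists_koszul_add (F : MinimalFreeResolution I) (p : ℕ) :
    ∀ (i : ℕ) (t : ℤ) (z : (Fin n → K) [⋀^Fin (p + 1)]→ₗ[K]
        (Fin (F.rank i) → MvPolynomial (Fin n) K)),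
      (∀ v, z v ∈ freePart K n (F.deg i) {t}) →
      (∀ v, koszul z v ∈ LinearMap.range (F.diff i)) →
      (∀ k, k = i + (p + 1) → ∀ e, F.deg k e < t + (p + 1)) →
      ∃ w w', z = koszul w + ((F.diff i).restrictScalars K).compAlternatingMap w' := by
  induction p with
  | zero =>
    intro i t z hz hk hd
    refine F.exists_koszul_add_of_lift z hz hk fun y hy _ => ?_
    obtain ⟨w, hw⟩ := exists_koszul_eq_of_lt (fun e => by simpa using hd _ rfl e) y hy
    exact ⟨w, 0, by ext1; simp [hw]⟩
  | succ p ih =>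
    intro i t z hz hk hd
    refine F.exists_koszul_add_of_lift z hz hk fun y hy hyz => ?_
    -- The sums `i + p` and `t + p` are unchanged when `p` drops by one, so the degree bound always
    -- concerns the same module. Stating it for `k` with an equation avoids transport between index
    -- types.
    refine ih (i + 1) (t + 1) y hy (fun v => ?_) fun k hk e => ?_
    · rw [← (F.exact_succ i).linearMap_ker_eq, LinearMap.mem_ker]
      have := congrArg (fun f => koszul f v) hyz
      simpa [koszul_koszul, koszul_compAlternatingMap] using this
    · have := hd k (by omega) e
      push_cast at this
      omega

end Resolution

end MonomialResolution

namespace MonomialResolution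

/-! ### Monomial ideals, socle monomials and the support bound. -/

variable {K : Type*} [Field K] {n : ℕ} {I : Ideal (MvPolynomial (Fin n) K)}

theorem smul_mk (f g : MvPolynomial (Fin n) K) :
    f • Ideal.Quotient.mk I g = Ideal.Quotient.mk I (f * g) :=
  rfl

theorem IsMonomialIdeal.mem_iff (hI : IsMonomialIdeal I) {f : MvPolynomial (Fin n) K} :
    f ∈ I ↔ ∀ a ∈ f.support, monomial a (1 : K) ∈ I := by
  obtain ⟨A, rfl⟩ := hI
  simp [mem_ideal_span_monomial_image]

theorem IsMonomialIdeal.mem_of_add_mem (hI : IsMonomialIdeal I) {s t : Set (Fin n →₀ ℕ)}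
    (hst : Disjoint s t) {f g : MvPolynomial (Fin n) K} (hf : f ∈ restrictSupport K s)
    (hg : g ∈ restrictSupport K t) (h : f + g ∈ I) : g ∈ I := by
  rw [hI.mem_iff] at h ⊢
  intro a ha
  refine h a (mem_support_iff.2 ?_)
  have : coeff a f = 0 := by
    by_contra hc
    exact Set.disjoint_left.1 hst ((mem_restrictSupport_iff K).1 hf (mem_support_iff.2 hc))
      ((mem_restrictSupport_iff K).1 hg ha)
  rw [coeff_add, this, zero_add]
  exact mem_support_iff.1 ha

theorem MinimalFreeResolution.aug_mem (F : MinimalFreeResolution I) {T : Set ℤ}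
    {f : Fin (F.rank 0) → MvPolynomial (Fin n) K} (hf : f ∈ freePart K n (F.deg 0) T) :
    ∃ g ∈ restrictSupport K {a : Fin n →₀ ℕ | (a.degree : ℤ) ∈ T},
      Ideal.Quotient.mk I g = F.aug f := by
  choose q hq hq' using F.aug_graded
  refine ⟨∑ e, f e * q e, Submodule.sum_mem _ fun e _ => ?_, ?_⟩
  · refine mul_mem_restrictSupport ?_ (mem_freePart.1 hf e) (hq e)
    intro a ha b hb
    simp only [Set.mem_ofPred_eq, map_add] at ha hb ⊢
    convert ha using 1
    push_cast
    omega
  · conv_rhs => rw [pi_eq_sum_univ' f, map_sum]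
    rw [map_sum]
    refine Finset.sum_congr rfl fun e _ => ?_
    rw [map_smul, ← hq' e]
    rfl

theorem MinimalFreeResolution.exists_aug_eq_monomial (F : MinimalFreeResolution I)
    (hI : IsMonomialIdeal I) (a : Fin n →₀ ℕ) :
    ∃ y ∈ freePart K n (F.deg 0) {(a.degree : ℤ)},
      F.aug y = Ideal.Quotient.mk I (monomial a 1) := by
  obtain ⟨y, hy⟩ := F.aug_surjective (Ideal.Quotient.mk I (monomial a 1))
  obtain ⟨g, hg, h, hh, rfl⟩ := exists_freePart_add (F.deg 0) {(a.degree : ℤ)} y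
  obtain ⟨g', hg', hgg⟩ := F.aug_mem hg
  obtain ⟨h', hh', hhh⟩ := F.aug_mem hh
  refine ⟨g, hg, ?_⟩
  -- `I` is homogeneous, so the part of the preimage outside degree `a.degree` maps to zero in
  -- `S/I`.
  have : h' ∈ I := by
    refine hI.mem_of_add_mem (Set.disjoint_left.2 fun _ ha hb => absurd ha hb)
      (f := g' - monomial a 1) (Submodule.sub_mem _ hg' ?_) hh' ?_
    · exact (monomial_mem_restrictSupport K).2 (Or.inl rfl)
    · rw [← Ideal.Quotient.eq_zero_iff_mem, map_add, map_sub, hgg, hhh, ← hy, map_add]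
      abel
  rw [← hy, map_add, ← hhh, Ideal.Quotient.eq_zero_iff_mem.2 this, add_zero]

theorem MinimalFreeResolution.IsLinearForSteps.deg_lt {F : MinimalFreeResolution I} {d r : ℕ}
    (h : F.IsLinearForSteps d r) {i : ℕ} (h1 : 1 ≤ i) (hr : i ≤ r) (e : Fin (F.rank i)) :
    F.deg i e < d + i := by
  by_contra! hc
  have := h i h1 hr (F.deg i e - i) (by omega)
  rw [betti, Fintype.card_eq_zero_iff] at this
  exact this.elim ⟨e, by ring⟩

/-- The determinant of the coordinates `τ 0, …, τ (p - 1)`. -/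
noncomputable def coordDet (K : Type*) [Field K] {n p : ℕ} (τ : Fin p → Fin n) :
    (Fin n → K) [⋀^Fin p]→ₗ[K] K :=
  Matrix.detRowAlternating.compLinearMap (LinearMap.funLeft K K τ)

theorem coordDet_apply_single {p : ℕ} {τ : Fin p → Fin n} (hτ : Function.Injective τ) :
    coordDet K τ (fun k => Pi.single (τ k) 1) = 1 := by
  have : (fun k => LinearMap.funLeft K K τ (Pi.single (τ k) 1)) = (1 : Matrix (Fin p) (Fin p) K) := by
    ext k l
    simp [LinearMap.funLeft_apply, Pi.single_apply, Matrix.one_apply, hτ.eq_iff, eq_comm]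
  change Matrix.det (fun k => LinearMap.funLeft K K τ (Pi.single (τ k) 1)) = 1
  rw [this, Matrix.det_one]

theorem coordDet_vecCons_of_notMem {p : ℕ} {τ : Fin (p + 1) → Fin n} {i : Fin n}
    (hi : i ∉ Set.range τ) (v : Fin p → Fin n → K) :
    coordDet K τ (Matrix.vecCons (Pi.single i 1) v) = 0 := by
  refine AlternatingMap.map_coord_zero (Matrix.detRowAlternating (R := K)) (0 : Fin (p + 1)) ?_
  ext l
  have : τ l ≠ i := fun h => hi ⟨l, h⟩
  simp [LinearMap.funLeft_apply, this]

/-- A socle monomial, relative to its own variables, prevents linearity of the resolution. -/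
theorem MinimalFreeResolution.exists_le_deg (F : MinimalFreeResolution I)
    (hI : IsMonomialIdeal I) {a : Fin n →₀ ℕ} {p : ℕ} (hcard : a.support.card = p + 1)
    (ha : monomial a (1 : K) ∉ I)
    (hsoc : ∀ i ∈ a.support, monomial (a + Finsupp.single i 1) (1 : K) ∈ I) :
    ∃ e, (a.degree : ℤ) + (p + 1) ≤ F.deg (p + 1) e := by
  by_contra! hd
  obtain ⟨y, hy, hya⟩ := F.exists_aug_eq_monomial hI a
  set τ := a.support.orderEmbOfFin hcard with hτ
  have hrange : ∀ i, i ∈ Set.range τ ↔ i ∈ a.support := fun i => by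
    rw [hτ, Finset.range_orderEmbOfFin, Finset.mem_coe]
  -- The chain `a ⊗ e_τ`, lifted to `F_0` through a homogeneous preimage `y` of `a`.
  set z := (LinearMap.toSpanSingleton K _ y).compAlternatingMap (coordDet K τ) with hz
  have hX : ∀ i ∈ a.support, (X i : MvPolynomial (Fin n) K) •
      Ideal.Quotient.mk I (monomial a (1 : K)) = 0 := fun i hi => by
    rw [smul_mk,
      Ideal.Quotient.eq_zero_iff_mem, X, monomial_mul, one_mul, add_comm]
    exact hsoc i hi
  obtain ⟨w, w', hw⟩ := F.exists_koszul_add p 0 a.degree z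
    (fun v => Submodule.smul_mem _ _ hy) (fun v => by
      rw [← F.exact_zero.linearMap_ker_eq, LinearMap.mem_ker, koszul_apply, map_sum]
      refine Finset.sum_eq_zero fun i _ => ?_
      by_cases hi : i ∈ a.support
      · rw [map_smul, hz, LinearMap.compAlternatingMap_apply, LinearMap.toSpanSingleton_apply,
          LinearMap.map_smul_of_tower, smul_comm, hya, hX i hi, smul_zero]
      · rw [hz, LinearMap.compAlternatingMap_apply,
          coordDet_vecCons_of_notMem (fun h => hi ((hrange i).1 h)), map_zero, smul_zero, map_zero])
    (fun k hk e => by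
      obtain rfl : k = p + 1 := by omega
      exact hd e)
  set v : Fin (p + 1) → Fin n → K := fun k => Pi.single (τ k) 1 with hv
  have h1 : Ideal.Quotient.mk I (monomial a (1 : K)) =
      ∑ i, (X i : MvPolynomial (Fin n) K) • F.aug (w (Matrix.vecCons (Pi.single i 1) v)) := by
    have := congrArg (fun f => F.aug (f v)) hw
    simp only [AlternatingMap.add_apply, map_add, LinearMap.compAlternatingMap_apply, hz,
      LinearMap.coe_restrictScalars, F.exact_zero.apply_apply_eq_zero, add_zero, koszul_apply,
      map_sum, map_smul, LinearMap.toSpanSingleton_apply] at this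
    rwa [hv, coordDet_apply_single τ.injective, one_smul, hya] at this
  choose g hg using fun i =>
    Ideal.Quotient.mk_surjective (I := I) (F.aug (w (Matrix.vecCons (Pi.single i 1) v)))
  have h2 : monomial a (1 : K) - ∑ i ∈ a.supportᶜ, X i * g i ∈ I := by
    rw [← Ideal.Quotient.eq_zero_iff_mem, map_sub, sub_eq_zero, h1, map_sum,
      ← Finset.sum_add_sum_compl a.support, Finset.sum_eq_zero, zero_add]
    · refine Finset.sum_congr rfl fun i _ => ?_
      rw [← hg, smul_mk]
    · intro i hi
      obtain ⟨k, rfl⟩ := (hrange i).2 hi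
      -- For `i` in the support, `e_i` already occurs among the arguments `v`.
      rw [w.map_eq_zero_of_eq (i := 0) (j := k.succ) _ (by simp [hv]) (Fin.succ_ne_zero k).symm,
        map_zero, smul_zero]
  -- No `x_i` with `i` outside the support divides `a`, so `a` keeps coefficient `1`.
  refine ha (hI.mem_iff.1 h2 a (mem_support_iff.2 ?_))
  rw [coeff_sub, coeff_sum, Finset.sum_eq_zero, coeff_monomial, if_pos rfl, sub_zero]
  · exact one_ne_zero
  · intro i hi
    rw [coeff_X_mul', if_neg (Finset.mem_compl.1 hi)]

theorem IsMonomialIdeal.monomial_mem_of_le {a b : Fin n →₀ ℕ} (hab : a ≤ b)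
    (ha : monomial a (1 : K) ∈ I) : monomial b (1 : K) ∈ I :=
  I.mem_of_dvd (monomial_dvd_monomial.2 ⟨Or.inr hab, dvd_rfl⟩) ha

theorem IsMonomialIdeal.exists_single_mem (hI : IsMonomialIdeal I)
    (hart : IsArtinianRing (MvPolynomial (Fin n) K ⧸ I)) (i : Fin n) :
    ∃ k : ℕ, monomial (Finsupp.single i k) (1 : K) ∈ I := by
  -- The powers of `x_i` stabilize: `x_i^k - x_i^(k+1) f ∈ I`, and its coefficient at `x_i^k` is
  -- `1`.
  obtain ⟨k, y, hy⟩ := IsArtinian.exists_pow_succ_smul_dvd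
    (Ideal.Quotient.mk I (X i)) (1 : MvPolynomial (Fin n) K ⧸ I)
  obtain ⟨f, rfl⟩ := Ideal.Quotient.mk_surjective y
  refine ⟨k, (hI.mem_iff (f := X i ^ k - X i ^ (k + 1) * f)).1 ?_ _ (mem_support_iff.2 ?_)⟩
  · rw [← Ideal.Quotient.eq_zero_iff_mem]
    simp only [smul_eq_mul, mul_one] at hy
    rw [map_sub, map_mul, map_pow, map_pow, ← hy, sub_self]
  · rw [coeff_sub, X_pow_eq_monomial, X_pow_eq_monomial, coeff_monomial, if_pos rfl,
      coeff_monomial_mul', if_neg, sub_zero]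
    · exact one_ne_zero
    · simp

/-- Every monomial outside `I` divides one with the same support that is a socle monomial
relative to its own variables. -/
theorem IsMonomialIdeal.exists_socle (hI : IsMonomialIdeal I)
    (hart : IsArtinianRing (MvPolynomial (Fin n) K ⧸ I)) {m : Fin n →₀ ℕ}
    (hm : monomial m (1 : K) ∉ I) :
    ∃ a, m ≤ a ∧ a.support = m.support ∧ monomial a (1 : K) ∉ I ∧
      ∀ i ∈ a.support, monomial (a + Finsupp.single i 1) (1 : K) ∈ I := by
  choose k hk using hI.exists_single_mem hart
  -- Exponents of monomials outside `I` are bounded by the pure powers in `I`, so a maximal one with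
  -- this support exists.
  obtain ⟨a, hma, ha⟩ := Set.Finite.exists_le_maximal
    (s := {b : Fin n →₀ ℕ | b.support = m.support ∧ monomial b (1 : K) ∉ I})
    ((Set.finite_Iic (Finsupp.equivFunOnFinite.symm k)).subset fun b hb i => by
      by_contra! h
      refine hb.2 (monomial_mem_of_le ?_ (hk i))
      rw [Finsupp.single_le_iff]
      exact h.le) (a := m) ⟨rfl, hm⟩
  refine ⟨a, hma, ha.prop.1, ha.prop.2, fun i hi => ?_⟩
  by_contra hc
  have hsupp : (a + Finsupp.single i 1).support = a.support := by
    ext j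
    by_cases hj : j = i
    · subst hj
      simpa using hi
    · simp [Ne.symm hj]
  have := ha.le_of_ge ⟨hsupp.trans ha.prop.1, hc⟩ le_self_add i
  simp at this

theorem IsMonomialIdeal.eq_top_of_degree_zero (hn : 1 ≤ n) (hI : IsMonomialIdeal I)
    (hart : IsArtinianRing (MvPolynomial (Fin n) K ⧸ I)) (hgen : IsGeneratedInDegree I 0) :
    I = ⊤ := by
  obtain ⟨T, hT, rfl⟩ := hgen
  obtain ⟨k, hk⟩ := hI.exists_single_mem hart ⟨0, hn⟩
  by_contra hne
  have hbot : Ideal.span T = ⊥ := by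
    rw [Ideal.span_eq_bot]
    intro f hf
    have hC := totalDegree_eq_zero_iff_eq_C.1 ((hT f hf).totalDegree_le.antisymm (Nat.zero_le _))
    by_contra h0
    refine hne (Ideal.eq_top_of_isUnit_mem _ (Ideal.subset_span hf) ?_)
    rw [hC] at h0 ⊢
    exact (IsUnit.mk0 _ fun h => h0 (by rw [h, C_0])).map C
  rw [hbot, Ideal.mem_bot, monomial_eq_zero] at hk
  exact one_ne_zero hk

theorem MinimalFreeResolution.IsLinearForSteps.lt_card_support {F : MinimalFreeResolution I}
    {d r : ℕ} (hlin : F.IsLinearForSteps d r) (hn : 1 ≤ n) (hI : IsMonomialIdeal I)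
    (hart : IsArtinianRing (MvPolynomial (Fin n) K ⧸ I)) (hgen : IsGeneratedInDegree I d)
    {m : Fin n →₀ ℕ} (hmd : m.degree = d) (hm : monomial m (1 : K) ∉ I) :
    r + 1 ≤ m.support.card := by
  by_contra! hr
  obtain ⟨a, hma, hsupp, ha, hsoc⟩ := hI.exists_socle hart hm
  rcases hp : m.support.card with _ | p
  -- Empty support forces `m = 1` and `d = 0`. Then `I` is generated by constants, and it is nonzero
  -- because it contains a power of a variable.
  · have h0 := hp
    obtain rfl : m = 0 := by simpa using h0
    obtain rfl : d = 0 := by simpa using hmd.symm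
    rw [hI.eq_top_of_degree_zero hn hart hgen] at hm
    exact hm trivial
  · obtain ⟨e, he⟩ := F.exists_le_deg hI ((congrArg _ hsupp).trans hp) ha hsoc
    have h1 := hlin.deg_lt (by omega) (by omega) e
    have h2 : m.degree ≤ a.degree := Finsupp.degree_mono hma
    push_cast at h1
    omega

end MonomialResolution

namespace MonomialResolution

/-! ### The Hilbert function bound. -/

variable {K : Type*} [Field K] {n : ℕ}

theorem quotientPart_eq_span (I : Ideal (MvPolynomial (Fin n) K)) (t : ℤ) :
    quotientPart I t = Submodule.span K
      ((fun a => Ideal.Quotient.mk I (monomial a 1)) '' {a : Fin n →₀ ℕ | (a.degree : ℤ) = t}) := by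
  rw [quotientPart, gradedPart, restrictSupport_eq_span, Submodule.map_span, Set.image_image]
  rfl

instance finiteDimensional_quotientPart (I : Ideal (MvPolynomial (Fin n) K)) (t : ℤ) :
    FiniteDimensional K (quotientPart I t) := by
  rw [quotientPart_eq_span]
  refine FiniteDimensional.span_of_finite K (Set.Finite.image _ ?_)
  refine (Finsupp.finite_of_degree_eq t.toNat).subset fun a ha => ?_
  simp only [Set.mem_ofPred_eq] at ha ⊢
  omega

/-- If every monomial of degree `t + c` outside `I` has at least `c` variables, then
`(S/I)_{t+c}` is the sum of the multiples of `(S/I)_t` by squarefree monomials of degree `c`. -/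
theorem hilbertFunction_le_of_le_card_support (I : Ideal (MvPolynomial (Fin n) K)) (t : ℤ) (c : ℕ)
    (h : ∀ m : Fin n →₀ ℕ, (m.degree : ℤ) = t + c → monomial m (1 : K) ∉ I → c ≤ m.support.card) :
    hilbertFunction I (t + c) ≤ n.choose c * hilbertFunction I t := by
  let e : Finset (Fin n) → Fin n →₀ ℕ := fun τ => Finsupp.indicator τ fun _ _ => 1
  let L : (Finset.powersetCard c (Finset.univ : Finset (Fin n)) → quotientPart I t) →ₗ[K]
      (MvPolynomial (Fin n) K ⧸ I) :=
    ∑ τ, (LinearMap.mulLeft K (Ideal.Quotient.mk I (monomial (e τ.1) 1))) ∘ₗ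
      (quotientPart I t).subtype ∘ₗ LinearMap.proj τ
  have hL : quotientPart I (t + c) ≤ LinearMap.range L := by
    rw [quotientPart_eq_span, Submodule.span_le]
    rintro _ ⟨m, hm, rfl⟩
    by_cases hmI : monomial m (1 : K) ∈ I
    · simp only [Ideal.Quotient.eq_zero_iff_mem.2 hmI]
      exact Submodule.zero_mem _
    -- Any `c` variables of `m` give a squarefree factor `e τ`; the cofactor `b` has degree `t`.
    · obtain ⟨τ, hτ, hcard⟩ := Finset.exists_subset_card_eq (h m hm hmI)
      have hle : e τ ≤ m := fun i => by
        by_cases hi : i ∈ τ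
        · simpa [e, Finsupp.indicator_apply, hi, Nat.one_le_iff_ne_zero] using hτ hi
        · simp [e, Finsupp.indicator_apply, hi]
      have hdeg : (e τ).degree = c := by
        simp [e, Finsupp.degree_eq_sum, Finsupp.indicator_apply, hcard]
      obtain ⟨b, rfl⟩ := exists_add_of_le hle
      have hb : Ideal.Quotient.mk I (monomial b 1) ∈ quotientPart I t := by
        rw [quotientPart_eq_span]
        refine Submodule.subset_span ⟨b, ?_, rfl⟩
        simp only [Set.mem_ofPred_eq, map_add, hdeg] at hm ⊢
        push_cast at hm
        omega
      refine ⟨Pi.single ⟨τ, by simp [hcard]⟩ ⟨_, hb⟩, ?_⟩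
      simp only [L, LinearMap.sum_apply]
      rw [Finset.sum_eq_single ⟨τ, by simp [hcard]⟩]
      · simp [← map_mul, monomial_mul]
      · intro τ' _ hne
        simp [Pi.single_eq_of_ne hne]
      · simp
  calc hilbertFunction I (t + c) ≤ Module.finrank K (LinearMap.range L) := Submodule.finrank_mono hL
    _ ≤ Module.finrank K (Finset.powersetCard c (Finset.univ : Finset (Fin n)) →
          quotientPart I t) := LinearMap.finrank_range_le L
    _ = n.choose c * hilbertFunction I t := by
      rw [Module.finrank_pi_fintype, Finset.sum_const, Finset.card_univ, Fintype.card_coe,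
        Finset.card_powersetCard, Finset.card_univ, Fintype.card_fin, smul_eq_mul]
      rfl

end MonomialResolution

theorem mainTheorem5 {K : Type*} [Field K] (n : ℕ) (hn : 1 ≤ n)
    (I : Ideal (MvPolynomial (Fin n) K)) (d r : ℕ)
    (hart : IsArtinianRing (MvPolynomial (Fin n) K ⧸ I))
    (hmon : MonomialResolution.IsMonomialIdeal I)
    (hgen : MonomialResolution.IsGeneratedInDegree I d)
    (F : MonomialResolution.MinimalFreeResolution I)
    (hlin : F.IsLinearForSteps d r) :
    (∀ m : Fin n →₀ ℕ, m.degree = d → MvPolynomial.monomial m (1 : K) ∉ I →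
      r + 1 ≤ m.support.card) ∧
    MonomialResolution.hilbertFunction I (d : ℤ) ≤
      n.choose (r + 1) * MonomialResolution.hilbertFunction I ((d : ℤ) - (r : ℤ) - 1) := by
  have key : ∀ m : Fin n →₀ ℕ, m.degree = d → MvPolynomial.monomial m (1 : K) ∉ I →
      r + 1 ≤ m.support.card := fun m hmd hm => hlin.lt_card_support hn hmon hart hgen hmd hm
  refine ⟨key, ?_⟩
  have hd : (d : ℤ) = ((d : ℤ) - (r : ℤ) - 1) + ((r + 1 : ℕ) : ℤ) := by
    push_cast
    ring
  conv_lhs => rw [hd]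
  refine MonomialResolution.hilbertFunction_le_of_le_card_support I _ _ fun m hm => key m ?_
  rw [← hd] at hm
  exact_mod_cast hm
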